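/- Let $\Lambda\in\mathbb R^{N\times N}$, $\Lambda\ne 0$, be a Metzler matrix (all off-diagonal entries are nonnegative) whose complex spectrum $\sigma(\Lambda)$ is contained in $\{z\in\mathbb C:\operatorname{Re} z\le 0\}$ and for which the algebraic and the geometric multiplicity of $0$ both equal $k\ge 0$ (so $k=\dim\ker\Lambda$). Write $\Lambda=S^+-S^-$ with $S^+,S^-\ge 0$ the entrywise positive and negative parts of $\Lambda$ (so $S^-$ is diagonal), and put $\varphi(x)=(1-e^{-x})/x$ for $x>0$, $\varphi(0)=1$. For a step size $\Delta t>0$, the scheme GeCo1 applied to $y'=\Lambda y$ is the iteration $y^{n+1}=g(y^n)$ with $$g(y)=y+\Delta t\,\varphi\Big(\Delta t\sum_{i=1}^N\frac{(S^-y)_i}{y_i}\Big)\Lambda y ,$$ where the quotient $(S^-y)_i/y_i=s^-_{ii}$ is extended continuously to $y_i=0$, so that $g$ is defined on all of $\mathbb R^N$. A fixed point $y^*$ of $g$ is called stable if for every $\varepsilon>0$ there is a $\delta>0$ such that $\|y^0-y^*\|<\delta$ implies $\|y^n-y^*\|<\varepsilon$ for all $n\ge 0$; it is called asymptotically stable if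 in addition there is a $c>0$ such that $\|y^0-y^*\|<c$ implies $\|y^n-y^*\|\to 0$. 1. Let $k>0$ and let $y^*$ be any steady state, i.e. $\Lambda y^*=0$ (in particular any positive one). Then $y^*$ is a stable fixed point of GeCo1 for every $\Delta t>0$. Moreover, there is a $\delta>0$ such that for every $y^0$ with $\|y^0-y^*\|<\delta$ for which $y^*$ is the steady state belonging to the initial value $y^0$, i.e. $n^{\mathsf T}y^0=n^{\mathsf T}y^*$ for all $n\in\ker\Lambda^{\mathsf T}$, the iterates $y^n$ of GeCo1 converge to $y^*$ for every $\Delta t>0$. 2. If $k=0$, then $0$ is an asymptotically stable fixed point of GeCo1 for every $\Delta t>0$. 3. The minimum $M=\min\{2|\operatorname{Re}\lambda|/|\lambda|^2:\lambda\in\sigma(\Lambda)\setminus\{0\}\}$ exists and satisfies $M\operatorname{tr}(S^-)\ge 1$. For every $\Delta t>0$, with $\Phi(\Delta t)=\Delta t\,\varphi(\Delta t\operatorname{tr}(S^-))$, the matrix $I+\Phi(\Delta t)\Lambda$ has the eigenvalue $1$ with algebraic multiplicity exactly $k$ (it is not an eigenvalue if $k=0$), and its other $N-k$ eigenvalues lie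 in the open unit disk. -/

import Mathlib

open Matrix Filter Topology

noncomputable section

/-- The linear system `y' = Λ y` is a positive system with stable steady states and exactly `k`
linear invariants: `Λ ≠ 0` is a Metzler matrix, its complex spectrum lies in the closed left
half-plane, and `0` has algebraic and geometric multiplicity `k`. -/
structure IsStableMetzlerSystem {N : ℕ} (Λ : Matrix (Fin N) (Fin N) ℝ) (k : ℕ) : Prop where
  ne_zero : Λ ≠ 0
  metzler : ∀ i j, i ≠ j → 0 ≤ Λ i j
  spectrum_re_nonpos : ∀ z ∈ spectrum ℂ (Λ.map Complex.ofReal), z.re ≤ 0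
  algebraic_mult : Λ.charpoly.rootMultiplicity 0 = k
  geometric_mult : Module.finrank ℝ (LinearMap.ker Λ.mulVecLin) = k

/-- The production part `S⁺` of `Λ = S⁺ - S⁻`: the entrywise positive part. -/
def productionMatrix {N : ℕ} (Λ : Matrix (Fin N) (Fin N) ℝ) : Matrix (Fin N) (Fin N) ℝ :=
  Λ.map fun a => max a 0

/-- The destruction part `S⁻` of `Λ = S⁺ - S⁻`: the entrywise negative part.
For a Metzler matrix it is diagonal. -/
def destructionMatrix {N : ℕ} (Λ : Matrix (Fin N) (Fin N) ℝ) : Matrix (Fin N) (Fin N) ℝ :=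
  Λ.map fun a => max (-a) 0

/-- The weight function `φ(x) = (1 - e⁻ˣ) / x` for `x > 0`, `φ(0) = 1`
(it is only evaluated at `x ≥ 0`). -/
def gecoPhi (x : ℝ) : ℝ :=
  if 0 < x then (1 - Real.exp (-x)) / x else 1

/-- The relative destruction rate `fᵢᴰ(y) / yᵢ` with `fᴰ(y) = S⁻ y`. For a Metzler matrix
`fᵢᴰ(y) = s⁻ᵢᵢ yᵢ`, so at `yᵢ = 0` the quotient is extended continuously by `s⁻ᵢᵢ`. -/
def relativeDestruction {N : ℕ} (Λ : Matrix (Fin N) (Fin N) ℝ) (y : Fin N → ℝ) (i : Fin N) : ℝ :=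
  if y i = 0 then destructionMatrix Λ i i else (destructionMatrix Λ *ᵥ y) i / y i

/-- The generating map `yⁿ ↦ yⁿ⁺¹` of the first order geometric conservative scheme GeCo1 with
step size `Δt`, applied to `y' = Λ y = S⁺ y - S⁻ y`:
`yⁿ⁺¹ = yⁿ + Δt φ(Δt ∑ᵢ fᵢᴰ(yⁿ) / yᵢⁿ) f(yⁿ)`. -/
def geco1 {N : ℕ} (Λ : Matrix (Fin N) (Fin N) ℝ) (Δt : ℝ) (y : Fin N → ℝ) : Fin N → ℝ :=
  y + (Δt * gecoPhi (Δt * ∑ i, relativeDestruction Λ y i)) •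
    (productionMatrix Λ *ᵥ y - destructionMatrix Λ *ᵥ y)

/-- `ystar` is a (Lyapunov) stable fixed point of the iteration `yⁿ⁺¹ = g(yⁿ)`. -/
def IsLyapunovStableFixedPoint {E : Type*} [NormedAddCommGroup E] (g : E → E) (ystar : E) :
    Prop :=
  g ystar = ystar ∧
    ∀ ε : ℝ, 0 < ε → ∃ δ : ℝ, 0 < δ ∧
      ∀ y₀ : E, ‖y₀ - ystar‖ < δ → ∀ n : ℕ, ‖g^[n] y₀ - ystar‖ < ε

/-- `ystar` is an asymptotically stable fixed point of the iteration `yⁿ⁺¹ = g(yⁿ)`. -/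
def IsAsymptoticallyStableFixedPoint {E : Type*} [NormedAddCommGroup E] (g : E → E)
    (ystar : E) : Prop :=
  IsLyapunovStableFixedPoint g ystar ∧
    ∃ c : ℝ, 0 < c ∧
      ∀ y₀ : E, ‖y₀ - ystar‖ < c → Tendsto (fun n : ℕ => ‖g^[n] y₀ - ystar‖) atTop (𝓝 0)

/-- `y` and `ystar` have the same values of all linear invariants of `y' = Λ y`, that is
`nᵀ y = nᵀ ystar` whenever `nᵀ Λ = 0`. -/
def SameLinearInvariants {N : ℕ} (Λ : Matrix (Fin N) (Fin N) ℝ) (y ystar : Fin N → ℝ) : Prop :=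
  ∀ n : Fin N → ℝ, n ᵥ* Λ = 0 → n ⬝ᵥ y = n ⬝ᵥ ystar

end

/-! Since `S⁻` is diagonal, the argument of `φ` is the constant `Δt τ` with `τ = tr S⁻`. Hence GeCo1
is the linear iteration with matrix `J = 1 + Φ Λ`, where `Φ τ = 1 - exp (-Δt τ) < 1`.

The matrix `Λ + τ` is entrywise nonnegative and its real eigenvalues are at most `τ`.
Perron–Frobenius puts its spectrum in the disk of radius `τ`, so `‖z‖² ≤ 2 |Re z| τ` for every
eigenvalue `z` of `Λ` (`normSq_le`). This gives `M τ ≥ 1`, and `‖1 + Φ z‖ < 1` for `z ≠ 0`.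

Semisimplicity of `0` yields a group inverse, hence a splitting into kernel and range along which `J
^ m` converges to a projection `Q` (`exists_tendsto_pow`). Convergent powers are bounded, which is
stability. The rows of `Q` are linear invariants, so `Q` kills `y⁰ - y*`, which is convergence. -/

/-! ### Perron–Frobenius bounds for nonnegative matrices -/

section PerronFrobenius

variable {n : Type*} [Fintype n] [DecidableEq n]

/-- A `μ ∈ spectrum` of a square matrix over a field has an eigenvector. -/
lemma Matrix.exists_eigenvector_of_mem_spectrum {K : Type*} [Field K] {A : Matrix n n K} {μ : K}
    (h : μ ∈ spectrum K A) : ∃ v, v ≠ 0 ∧ A *ᵥ v = μ • v := by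
  rw [Matrix.mem_spectrum_iff_isRoot_charpoly, Polynomial.IsRoot, Matrix.eval_charpoly,
    ← Matrix.exists_mulVec_eq_zero_iff] at h
  obtain ⟨v, hv, h⟩ := h
  refine ⟨v, hv, ?_⟩
  rw [sub_mulVec, sub_eq_zero] at h
  rw [← h]
  simp [Matrix.scalar_apply, ← Matrix.smul_one_eq_diagonal, smul_mulVec]

lemma Matrix.mem_spectrum_of_eigenvector {K : Type*} [Field K] {A : Matrix n n K} {μ : K}
    {v : n → K} (hv : v ≠ 0) (h : A *ᵥ v = μ • v) : μ ∈ spectrum K A := by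
  rw [Matrix.mem_spectrum_iff_isRoot_charpoly, Polynomial.IsRoot, Matrix.eval_charpoly,
    ← Matrix.exists_mulVec_eq_zero_iff]
  refine ⟨v, hv, ?_⟩
  rw [sub_mulVec, sub_eq_zero, h]
  simp [Matrix.scalar_apply, ← Matrix.smul_one_eq_diagonal, smul_mulVec]

/-- For a nonnegative matrix `A` and `r > 0` above all real eigenvalues, `r - A` is a nonsingular
M-matrix: `(r - A) x = 1` has a positive solution. -/
lemma Matrix.exists_pos_smul_sub_mulVec_eq_one {A : Matrix n n ℝ} (hA : ∀ i j, 0 ≤ A i j)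
    {r : ℝ} (hr : 0 < r) (hspec : ∀ s ∈ spectrum ℝ A, s < r) :
    ∃ x : n → ℝ, (∀ i, 0 < x i) ∧ ∀ i, r * x i = 1 + (A *ᵥ x) i := by
  rcases isEmpty_or_nonempty n with hn | hn
  · exact ⟨0, fun i => hn.elim i, fun i => hn.elim i⟩
  -- Continuity argument: the least entry of `x s = (s - A)⁻¹ 1` is continuous on `s ≥ r`, never
  -- zero, and positive at some large `s`, hence positive at `r`.
  set R : ℝ → Matrix n n ℝ := fun s => scalar n s - A with hR
  have hdet : ∀ s, r ≤ s → (R s).det ≠ 0 := by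
    intro s hs h0
    refine absurd (hspec s ?_) (not_lt.2 hs)
    rw [Matrix.mem_spectrum_iff_isRoot_charpoly, Polynomial.IsRoot, Matrix.eval_charpoly]
    exact h0
  set x : ℝ → n → ℝ := fun s => (R s)⁻¹ *ᵥ 1 with hx
  have hRc : Continuous R := by
    refine Continuous.sub ?_ continuous_const
    exact (continuous_pi fun _ => continuous_id).matrix_diagonal
  have hxc : ContinuousOn x (Set.Ici r) := by
    have h1 : ContinuousOn (fun s => ((R s).det)⁻¹ • ((R s).adjugate *ᵥ (1 : n → ℝ)))
        (Set.Ici r) := by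
      refine ContinuousOn.smul (ContinuousOn.inv₀ hRc.matrix_det.continuousOn hdet) ?_
      exact (hRc.matrix_adjugate.matrix_mulVec continuous_const).continuousOn
    refine h1.congr fun s _ => ?_
    simp [hx, Matrix.inv_def, smul_mulVec]
  have hxeq : ∀ s, r ≤ s → ∀ i, s * x s i = 1 + (A *ᵥ x s) i := by
    intro s hs i
    have h1 : R s *ᵥ x s = 1 := by
      rw [hx]
      simp only [mulVec_mulVec]
      rw [Matrix.mul_nonsing_inv _ (isUnit_iff_ne_zero.2 (hdet s hs)), one_mulVec]
    have h2 := congrFun h1 i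
    rw [hR] at h2
    simp only [sub_mulVec, Pi.sub_apply, Pi.one_apply, Matrix.scalar_apply,
      Matrix.mulVec_diagonal] at h2
    linarith
  have hmc : ContinuousOn (fun s => Finset.univ.inf' Finset.univ_nonempty (x s)) (Set.Ici r) := by
    refine ContinuousOn.finset_inf'_apply Finset.univ_nonempty fun i _ => ?_
    exact (continuous_apply i).comp_continuousOn hxc
  set m : ℝ → ℝ := fun s => Finset.univ.inf' Finset.univ_nonempty (x s) with hm
  have hmle : ∀ s i, m s ≤ x s i := fun s i => Finset.inf'_le _ (Finset.mem_univ i)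
  have hmex : ∀ s, ∃ i, m s = x s i := fun s => by
    obtain ⟨i, -, hi⟩ := Finset.exists_mem_eq_inf' Finset.univ_nonempty (x s)
    exact ⟨i, hi⟩
  have hlow : ∀ s i, (∑ j, A i j) * m s ≤ (A *ᵥ x s) i := by
    intro s i
    rw [Finset.sum_mul]
    exact Finset.sum_le_sum fun j _ => mul_le_mul_of_nonneg_left (hmle s j) (hA i j)
  have hne : ∀ s, r ≤ s → m s ≠ 0 := by
    intro s hs h0
    obtain ⟨i, hi⟩ := hmex s
    have h1 := hxeq s hs i
    have h2 := hlow s i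
    rw [← hi, h0] at h1
    rw [h0] at h2
    linarith
  -- `b` exceeds every row sum, so the row of the least entry gives `(b - row sum) * m b ≥ 1`.
  set b : ℝ := r + ∑ i, ∑ j, A i j with hb
  have hrb : r ≤ b := by
    have : 0 ≤ ∑ i, ∑ j, A i j := Finset.sum_nonneg fun i _ => Finset.sum_nonneg fun j _ => hA i j
    linarith
  have hmb : 0 < m b := by
    obtain ⟨i, hi⟩ := hmex b
    have h1 := hxeq b hrb i
    have h2 := hlow b i
    have h3 : ∑ j, A i j ≤ ∑ i, ∑ j, A i j :=
      Finset.single_le_sum (f := fun i => ∑ j, A i j)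
        (fun i _ => Finset.sum_nonneg fun j _ => hA i j) (Finset.mem_univ i)
    rw [← hi] at h1
    by_contra hcon
    nlinarith [mul_nonneg (by linarith : (0:ℝ) ≤ b - ∑ j, A i j) (neg_nonneg.2 (not_lt.1 hcon))]
  have hmr : 0 < m r := by
    by_contra hcon
    obtain ⟨s, hs, h0⟩ := intermediate_value_Icc hrb (hmc.mono Set.Icc_subset_Ici_self)
      ⟨not_lt.1 hcon, hmb.le⟩
    exact hne s hs.1 h0
  exact ⟨x r, fun i => hmr.trans_le (hmle r i), hxeq r le_rfl⟩

/-- Weak Perron–Frobenius theorem: if `τ ≥ 0` bounds all real eigenvalues of a nonnegative matrix,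
then it bounds the modulus of all complex ones. -/
lemma Matrix.norm_le_of_mem_spectrum_of_nonneg {A : Matrix n n ℝ} (hA : ∀ i j, 0 ≤ A i j)
    {τ : ℝ} (hτ : 0 ≤ τ) (hspec : ∀ s ∈ spectrum ℝ A, s ≤ τ) {z : ℂ}
    (hz : z ∈ spectrum ℂ (A.map Complex.ofReal)) : ‖z‖ ≤ τ := by
  by_contra hcon
  push Not at hcon
  obtain ⟨v, hv, hAv⟩ := Matrix.exists_eigenvector_of_mem_spectrum hz
  obtain ⟨x, hx, hxeq⟩ := Matrix.exists_pos_smul_sub_mulVec_eq_one hA (hτ.trans_lt hcon)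
    fun s hs => (hspec s hs).trans_lt hcon
  obtain ⟨i₁, hi₁⟩ := Function.ne_iff.1 hv
  -- In the sup norm weighted by `x`, the row of a maximal entry gives `‖z‖ c x i ≤ c (A x) i = c
  -- (‖z‖ x i - 1)`, a contradiction.
  obtain ⟨i, -, hi⟩ := Finset.exists_max_image Finset.univ (fun i => ‖v i‖ / x i)
    ⟨i₁, Finset.mem_univ _⟩
  set c := ‖v i‖ / x i with hc
  have hcpos : 0 < c :=
    (div_pos (norm_pos_iff.2 hi₁) (hx i₁)).trans_le (hi i₁ (Finset.mem_univ _))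
  have hle : ∀ j, ‖v j‖ ≤ c * x j := fun j => (div_le_iff₀ (hx j)).1 (hi j (Finset.mem_univ _))
  have heq : ‖v i‖ = c * x i := by rw [hc, div_mul_cancel₀ _ (hx i).ne']
  have h1 : ‖z‖ * ‖v i‖ ≤ ∑ j, A i j * ‖v j‖ := by
    rw [← norm_mul]
    have : z * v i = ∑ j, (A i j : ℂ) * v j := by
      have := congrFun hAv i
      simpa [Matrix.mulVec, dotProduct] using this.symm
    rw [this]
    refine (norm_sum_le _ _).trans (Finset.sum_le_sum fun j _ => ?_)
    rw [norm_mul, Complex.norm_real, Real.norm_of_nonneg (hA i j)]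
  have h2 : ∑ j, A i j * ‖v j‖ ≤ c * (A *ᵥ x) i := by
    rw [Matrix.mulVec, dotProduct, Finset.mul_sum]
    refine Finset.sum_le_sum fun j _ => ?_
    calc A i j * ‖v j‖ ≤ A i j * (c * x j) := mul_le_mul_of_nonneg_left (hle j) (hA i j)
      _ = c * (A i j * x j) := by ring
  have h3 := hxeq i
  rw [heq] at h1
  nlinarith

end PerronFrobenius

/-! ### Consequences of the semisimple eigenvalue zero -/

section SemisimpleZero

variable {N : ℕ} {Λ : Matrix (Fin N) (Fin N) ℝ} {k : ℕ}

lemma Matrix.mem_maxGenEigenspace_mulVecLin {n K : Type*} [Fintype n] [DecidableEq n] [Field K]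
    {A : Matrix n n K} {μ : K} {v : n → K} :
    v ∈ Module.End.maxGenEigenspace A.mulVecLin μ ↔ ∃ m : ℕ, (A - μ • 1) ^ m *ᵥ v = 0 := by
  rw [Module.End.mem_maxGenEigenspace]
  refine exists_congr fun m => ?_
  have : A.mulVecLin - μ • 1 = Matrix.toLin' (A - μ • 1) := by
    simp [← Matrix.toLin'_apply', Matrix.toLin'_one, map_sub, Module.End.one_eq_id]
  rw [this, ← Matrix.toLin'_pow, Matrix.toLin'_apply]

namespace IsStableMetzlerSystem

/-- The generalized eigenspace at `0` has the algebraic multiplicity as dimension, so equal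
multiplicities make it the kernel. -/
lemma mulVec_eq_zero_of_pow (h : IsStableMetzlerSystem Λ k) {m : ℕ} {v : Fin N → ℝ}
    (hv : Λ ^ m *ᵥ v = 0) : Λ *ᵥ v = 0 := by
  have hle : LinearMap.ker Λ.mulVecLin ≤ Module.End.maxGenEigenspace Λ.mulVecLin 0 := fun w hw =>
    Matrix.mem_maxGenEigenspace_mulVecLin.2 ⟨1, by simpa using hw⟩
  have heq := Submodule.eq_of_le_of_finrank_eq hle (by
    rw [LinearMap.finrank_maxGenEigenspace_eq, Matrix.charpoly_mulVecLin, h.algebraic_mult,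
      h.geometric_mult])
  have : v ∈ LinearMap.ker Λ.mulVecLin := by
    rw [heq]
    exact Matrix.mem_maxGenEigenspace_mulVecLin.2 ⟨m, by simpa using hv⟩
  simpa using this

/-- Take `q` to be the characteristic polynomial without its factor `X ^ k`. Cayley–Hamilton gives
`Λ ^ k q(Λ) = 0`, and semisimplicity lowers the exponent to one. -/
lemma exists_charpoly_eq (h : IsStableMetzlerSystem Λ k) :
    ∃ q : Polynomial ℝ, q.eval 0 ≠ 0 ∧ q ∣ Λ.charpoly ∧ Λ * Polynomial.aeval Λ q = 0 := by
  obtain ⟨q, hq, hroot⟩ := Polynomial.exists_eq_pow_rootMultiplicity_mul_and_not_dvd Λ.charpoly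
    (Matrix.charpoly_monic Λ).ne_zero 0
  refine ⟨q, ?_, ⟨_, by rw [mul_comm]; exact hq⟩, ?_⟩
  · rwa [Polynomial.dvd_iff_isRoot] at hroot
  · have hCH := Matrix.aeval_self_charpoly Λ
    rw [hq] at hCH
    simp only [map_zero, sub_zero, map_mul, map_pow, Polynomial.aeval_X] at hCH
    refine Matrix.ext_of_mulVec_single fun i => ?_
    rw [← mulVec_mulVec, zero_mulVec]
    refine h.mulVec_eq_zero_of_pow (m := Λ.charpoly.rootMultiplicity 0) ?_
    rw [mulVec_mulVec, hCH, zero_mulVec]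

/-- `Λ` has a group inverse: a `G` commuting with `Λ` with `Λ G Λ = Λ`. -/
lemma exists_groupInverse (h : IsStableMetzlerSystem Λ k) :
    ∃ G : Matrix (Fin N) (Fin N) ℝ, Commute Λ G ∧ Λ * (Λ * G) = Λ := by
  obtain ⟨q, hq0, -, hq⟩ := h.exists_charpoly_eq
  have hdecomp := congrArg (Polynomial.aeval Λ) (Polynomial.divX_mul_X_add q)
  rw [Polynomial.coeff_zero_eq_eval_zero] at hdecomp
  simp only [map_add, map_mul, Polynomial.aeval_X, Polynomial.aeval_C] at hdecomp
  have hcomm : Commute Λ (Polynomial.aeval Λ q.divX) :=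
    by simpa using (Commute.all Polynomial.X q.divX).map (Polynomial.aeval Λ)
  -- With `q = X r + q(0)`, the relation `Λ q(Λ) = 0` reads `Λ² r(Λ) = -q(0) Λ`.
  refine ⟨(-(q.eval 0)⁻¹) • Polynomial.aeval Λ q.divX, hcomm.smul_right _, ?_⟩
  rw [← hdecomp, mul_add, ← hcomm.eq, Algebra.algebraMap_eq_smul_one, mul_smul_comm, mul_one] at hq
  rw [mul_smul_comm, mul_smul_comm, eq_neg_of_add_eq_zero_left hq, smul_neg, neg_smul, neg_neg,
    smul_smul, inv_mul_cancel₀ hq0, one_smul]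

/-- A constant `q` would force `Λ = 0`; otherwise any complex root of `q` serves. -/
lemma exists_mem_spectrum_ne_zero (h : IsStableMetzlerSystem Λ k) :
    ∃ z ∈ spectrum ℂ (Λ.map Complex.ofReal), z ≠ 0 := by
  obtain ⟨q, hq0, hdvd, hq⟩ := h.exists_charpoly_eq
  have hdeg : q.degree ≠ 0 := by
    intro hdeg
    obtain ⟨c, hc⟩ : ∃ c, q = Polynomial.C c := ⟨_, Polynomial.eq_C_of_degree_eq_zero hdeg⟩
    rw [hc, Polynomial.eval_C] at hq0
    rw [hc, Polynomial.aeval_C, Algebra.algebraMap_eq_smul_one, mul_smul_comm, mul_one] at hq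
    exact h.ne_zero ((smul_eq_zero.1 hq).resolve_left hq0)
  obtain ⟨z, hz⟩ := IsAlgClosed.exists_aeval_eq_zero ℂ q hdeg
  refine ⟨z, ?_, ?_⟩
  · rw [Matrix.mem_spectrum_iff_isRoot_charpoly]
    have : (Λ.map Complex.ofReal).charpoly = Λ.charpoly.map (algebraMap ℝ ℂ) :=
      Matrix.charpoly_map Λ (algebraMap ℝ ℂ)
    rw [this, Polynomial.IsRoot, Polynomial.eval_map_algebraMap]
    exact zero_dvd_iff.1 (hz ▸ map_dvd (Polynomial.aeval z) hdvd)
  · rintro rfl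
    rw [← map_zero (algebraMap ℝ ℂ), Polynomial.aeval_algebraMap_apply] at hz
    simp only [Polynomial.coe_aeval_eq_eval] at hz
    exact hq0 ((algebraMap ℝ ℂ).injective (by simpa using hz))

end IsStableMetzlerSystem

end SemisimpleZero

/-! ### Convergence and boundedness of matrix powers -/

section PowerLimits

open scoped ENNReal NNReal in
/-- In a complex Banach algebra, the powers of an element whose spectrum lies in the open unit disk
tend to zero. -/
lemma spectrum.tendsto_pow_zero_of_forall_norm_lt_one {A : Type*} [NormedRing A]
    [NormedAlgebra ℂ A] [CompleteSpace A] (a : A) (ha : ∀ z ∈ spectrum ℂ a, ‖z‖ < 1) :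
    Tendsto (fun n : ℕ => a ^ n) atTop (𝓝 0) := by
  rcases subsingleton_or_nontrivial A with hA | hA
  · exact tendsto_const_nhds.congr fun n => Subsingleton.elim _ _
  have hρ : spectralRadius ℂ a < (1 : ℝ≥0) :=
    spectrum.spectralRadius_lt_of_forall_lt a fun z hz => by
      have := ha z hz
      rwa [← NNReal.coe_lt_coe, coe_nnnorm, NNReal.coe_one]
  obtain ⟨r, hr, hr1⟩ := ENNReal.lt_iff_exists_nnreal_btwn.1 hρ
  have hr1' : (r : ℝ) < 1 := by exact_mod_cast hr1
  rw [tendsto_zero_iff_norm_tendsto_zero]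
  refine squeeze_zero' (Eventually.of_forall fun n => norm_nonneg _) ?_
    (tendsto_pow_atTop_nhds_zero_of_lt_one r.coe_nonneg hr1')
  -- Gelfand's formula gives `‖a ^ n‖ ≤ r ^ n` eventually.
  filter_upwards [(spectrum.pow_nnnorm_pow_one_div_tendsto_nhds_spectralRadius a).eventually_lt_const
    hr, eventually_gt_atTop 0] with n hn hn0
  have hn' : (n : ℝ) ≠ 0 := by exact_mod_cast hn0.ne'
  have h1 := ENNReal.rpow_le_rpow hn.le (Nat.cast_nonneg n)
  rw [← ENNReal.rpow_mul, one_div, inv_mul_cancel₀ hn', ENNReal.rpow_one,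
    ENNReal.rpow_natCast] at h1
  exact_mod_cast h1

attribute [local instance] Matrix.linftyOpNormedRing Matrix.linftyOpNormedAlgebra in
lemma Matrix.tendsto_pow_zero_of_forall_norm_lt_one {n : Type*} [Fintype n] [DecidableEq n]
    (B : Matrix n n ℝ) (hB : ∀ z ∈ spectrum ℂ (B.map Complex.ofReal), ‖z‖ < 1) :
    Tendsto (fun m : ℕ => B ^ m) atTop (𝓝 0) := by
  have h := spectrum.tendsto_pow_zero_of_forall_norm_lt_one _ hB
  have hre : Continuous fun C : Matrix n n ℂ => C.map Complex.re :=
    Continuous.matrix_map continuous_id Complex.continuous_re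
  have h2 := (hre.tendsto 0).comp h
  have h0 : (0 : Matrix n n ℂ).map Complex.re = 0 := by ext; simp
  rw [h0] at h2
  refine h2.congr fun m => ?_
  have : (B ^ m).map Complex.ofReal = (B.map Complex.ofReal) ^ m :=
    map_pow Complex.ofRealHom.mapMatrix B m
  rw [Function.comp_apply, ← this]
  ext
  simp

attribute [local instance] Matrix.linftyOpNormedRing in
lemma Matrix.exists_norm_pow_mulVec_le_of_tendsto {n : Type*} [Fintype n] [DecidableEq n]
    {J Q : Matrix n n ℝ} (h : Tendsto (fun m : ℕ => J ^ m) atTop (𝓝 Q)) :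
    ∃ C : ℝ, 0 < C ∧ ∀ (m : ℕ) (v : n → ℝ), ‖J ^ m *ᵥ v‖ ≤ C * ‖v‖ := by
  obtain ⟨C, hC⟩ := (Metric.isBounded_range_of_tendsto _ h).exists_norm_le
  refine ⟨max C 1, by positivity, fun m v => ?_⟩
  refine (Matrix.linfty_opNorm_mulVec _ _).trans ?_
  exact mul_le_mul_of_nonneg_right ((hC _ ⟨m, rfl⟩).trans (le_max_left _ _)) (norm_nonneg _)

end PowerLimits

/-! ### Spectra of `Λ` and `1 + Φ Λ` -/

namespace IsStableMetzlerSystem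

variable {N : ℕ} {Λ : Matrix (Fin N) (Fin N) ℝ} {k : ℕ}

lemma trace_nonneg : 0 ≤ (destructionMatrix Λ).trace :=
  Finset.sum_nonneg fun _ _ => le_max_right _ _

/-- This is `‖z + τ‖ ≤ τ` squared and expanded. -/
lemma normSq_le (h : IsStableMetzlerSystem Λ k) {z : ℂ}
    (hz : z ∈ spectrum ℂ (Λ.map Complex.ofReal)) :
    ‖z‖ ^ 2 ≤ 2 * |z.re| * (destructionMatrix Λ).trace := by
  set τ := (destructionMatrix Λ).trace with hτ
  have hτ0 : 0 ≤ τ := trace_nonneg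
  obtain ⟨v, hv, hzv⟩ := Matrix.exists_eigenvector_of_mem_spectrum hz
  have hmap : (Λ + τ • 1).map Complex.ofReal = Λ.map Complex.ofReal + (τ : ℂ) • 1 := by
    ext i j
    by_cases hij : i = j <;> simp [hij]
  have hz' : z + τ ∈ spectrum ℂ ((Λ + τ • 1).map Complex.ofReal) := by
    refine Matrix.mem_spectrum_of_eigenvector hv ?_
    rw [hmap, add_mulVec, hzv, smul_mulVec, one_mulVec, add_smul]
  have hnn : ∀ i j, 0 ≤ (Λ + τ • 1) i j := by
    intro i j
    rcases eq_or_ne i j with rfl | hij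
    · have h1 : destructionMatrix Λ i i ≤ τ :=
        Finset.single_le_sum (f := fun i => destructionMatrix Λ i i)
          (fun _ _ => le_max_right _ _) (Finset.mem_univ i)
      have h2 : -Λ i i ≤ destructionMatrix Λ i i := le_max_left _ _
      simp
      linarith
    · simpa [hij] using h.metzler i j hij
  have hnorm := Matrix.norm_le_of_mem_spectrum_of_nonneg hnn hτ0 (fun s hs => ?_) hz'
  · have hre := h.spectrum_re_nonpos z hz
    rw [abs_of_nonpos hre]
    have h1 : ‖z + τ‖ ^ 2 ≤ τ ^ 2 := by gcongr
    rw [Complex.sq_norm, Complex.normSq_apply] at h1 ⊢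
    simp at h1
    nlinarith
  · obtain ⟨w, hw, hsw⟩ := Matrix.exists_eigenvector_of_mem_spectrum hs
    have hw' : (fun i => (w i : ℂ)) ≠ 0 := by
      intro h0
      refine hw (funext fun i => ?_)
      simpa using congrFun h0 i
    have := h.spectrum_re_nonpos ((s - τ : ℝ) : ℂ) (Matrix.mem_spectrum_of_eigenvector hw' ?_)
    · rw [Complex.ofReal_re] at this
      linarith
    · ext i
      have h1 := congrFun hsw i
      rw [add_mulVec, smul_mulVec, one_mulVec, Pi.add_apply, Pi.smul_apply, Pi.smul_apply,
        smul_eq_mul, smul_eq_mul] at h1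
      have h2 : (Λ *ᵥ w) i = (s - τ) * w i := by linarith
      have h3 := congrArg Complex.ofReal h2
      simpa [mulVec, dotProduct] using h3

lemma trace_pos (h : IsStableMetzlerSystem Λ k) : 0 < (destructionMatrix Λ).trace := by
  refine lt_of_le_of_ne trace_nonneg fun h0 => ?_
  obtain ⟨z, hz, hz0⟩ := h.exists_mem_spectrum_ne_zero
  have := h.normSq_le hz
  rw [← h0, mul_zero] at this
  have : 0 < ‖z‖ ^ 2 := by positivity
  linarith

/-- One has `‖1 + Φ z‖² = 1 + Φ (2 Re z + Φ ‖z‖²)`, and `Φ ‖z‖² ≤ 2 |Re z| Φ τ < 2 |Re z|`. The same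
bound excludes nonzero imaginary eigenvalues. -/
lemma norm_one_add_smul_lt_one (h : IsStableMetzlerSystem Λ k) {Φ : ℝ} (hΦ : 0 < Φ)
    (hΦτ : Φ * (destructionMatrix Λ).trace < 1) {z : ℂ}
    (hz : z ∈ spectrum ℂ (Λ.map Complex.ofReal)) (hz0 : z ≠ 0) : ‖1 + Φ * z‖ < 1 := by
  have h1 := h.normSq_le hz
  rw [abs_of_nonpos (h.spectrum_re_nonpos z hz)] at h1
  have h2 : 0 < ‖z‖ ^ 2 := by positivity
  rw [← abs_of_nonneg (norm_nonneg (1 + (Φ : ℂ) * z)), ← sq_lt_one_iff_abs_lt_one]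
  rw [Complex.sq_norm, Complex.normSq_apply] at h1 h2 ⊢
  simp
  have hre : z.re < 0 := by
    by_contra hcon
    nlinarith [mul_nonneg (not_lt.1 hcon) (trace_nonneg (Λ := Λ))]
  have h3 : Φ * (z.re * z.re + z.im * z.im) ≤ -2 * z.re * (Φ * (destructionMatrix Λ).trace) := by
    nlinarith [mul_le_mul_of_nonneg_left h1 hΦ.le]
  have h4 : -2 * z.re * (Φ * (destructionMatrix Λ).trace) < -2 * z.re := by nlinarith
  nlinarith [mul_lt_mul_of_pos_left (h3.trans_lt h4) hΦ]

/-- The powers of `1 + Φ Λ` converge to the projection onto `ker Λ` along `range Λ`. -/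
lemma exists_tendsto_pow (h : IsStableMetzlerSystem Λ k) :
    ∃ Q : Matrix (Fin N) (Fin N) ℝ, Λ * Q = 0 ∧ Q * Λ = 0 ∧
      ∀ Φ : ℝ, 0 < Φ → Φ * (destructionMatrix Λ).trace < 1 →
        Tendsto (fun m : ℕ => (1 + Φ • Λ) ^ m) atTop (𝓝 Q) := by
  obtain ⟨G, hcomm, hG⟩ := h.exists_groupInverse
  have hG' : Λ * G * Λ = Λ := by rw [mul_assoc, ← hcomm.eq, hG]
  have hPP : Λ * G * (Λ * G) = Λ * G := by rw [← mul_assoc, hG']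
  refine ⟨1 - Λ * G, by rw [mul_sub, mul_one, hG, sub_self],
    by rw [sub_mul, one_mul, hG', sub_self], fun Φ hΦ hΦτ => ?_⟩
  set P := Λ * G with hP
  set J := 1 + Φ • Λ with hJ
  have hJP : J * P = P * J := by
    rw [hJ, add_mul, mul_add, one_mul, mul_one, smul_mul_assoc, mul_smul_comm, hG', hP, hG]
  -- `J` commutes with the projection `P` and is the identity on the range of `1 - P`.
  have hpow : ∀ m : ℕ, J ^ m = (J * P) ^ m * P + (1 - P) := by
    intro m
    induction m with
    | zero => simp
    | succ m ih =>
      have hJQ : J * (1 - P) = 1 - P := by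
        rw [hJ, add_mul, one_mul, smul_mul_assoc, mul_sub, mul_one, hP, hG, sub_self, smul_zero,
          add_zero]
      have hc : Commute (J * P) P := by
        change J * P * P = P * (J * P)
        rw [← mul_assoc P, ← hJP]
      have h1 : P * (J * P) ^ m * P = (J * P) ^ m * P := by
        rw [((hc.pow_left m).eq).symm, mul_assoc, hPP]
      rw [pow_succ', ih, mul_add, hJQ, pow_succ', mul_assoc (J * P), mul_assoc J P, ← mul_assoc P,
        h1]
  have hB : Tendsto (fun m : ℕ => (J * P) ^ m) atTop (𝓝 0) := by
    refine Matrix.tendsto_pow_zero_of_forall_norm_lt_one _ fun z hz => ?_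
    rcases eq_or_ne z 0 with rfl | hz0
    · simp
    obtain ⟨v, hv, hzv⟩ := Matrix.exists_eigenvector_of_mem_spectrum hz
    set c := (Complex.ofRealHom.mapMatrix : Matrix (Fin N) (Fin N) ℝ →+* _) with hc
    change c (J * P) *ᵥ v = z • v at hzv
    -- An eigenvector of `J P` with `z ≠ 0` lies in the range of `P`. It is thus an eigenvector of
    -- `Λ`, with nonzero eigenvalue because `P = G Λ` fixes it.
    have hPv : c P *ᵥ v = v := by
      have h1 : z • (c P *ᵥ v) = z • v := by
        rw [← mulVec_smul, ← hzv, mulVec_mulVec, ← map_mul, ← mul_assoc, ← hJP, mul_assoc, hPP]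
      exact smul_right_injective _ hz0 h1
    have hcJ : c J = 1 + (Φ : ℂ) • c Λ := by
      ext i j
      by_cases hij : i = j <;> simp [hc, hJ, hij]
    rw [map_mul, ← mulVec_mulVec, hPv, hcJ, add_mulVec, one_mulVec, smul_mulVec] at hzv
    have hΦ0 : (Φ : ℂ) ≠ 0 := by exact_mod_cast hΦ.ne'
    have hΛv : c Λ *ᵥ v = ((z - 1) / Φ) • v := by
      rw [div_eq_inv_mul, mul_smul, sub_smul, one_smul, ← hzv, add_sub_cancel_left,
        inv_smul_smul₀ hΦ0]
    have hw0 : (z - 1) / Φ ≠ 0 := by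
      intro h0
      rw [h0, zero_smul] at hΛv
      rw [hP, hcomm.eq, map_mul, ← mulVec_mulVec, hΛv, mulVec_zero] at hPv
      exact hv hPv.symm
    have := h.norm_one_add_smul_lt_one hΦ hΦτ (Matrix.mem_spectrum_of_eigenvector hv hΛv) hw0
    rwa [mul_div_cancel₀ _ hΦ0, add_sub_cancel] at this
  have := (hB.mul_const P).add_const (1 - P)
  rw [zero_mul, zero_add] at this
  exact this.congr fun m => (hpow m).symm

/-- Since `(J - 1) ^ m = Φ ^ m Λ ^ m`, the generalized eigenspaces of `J` at `1` and of `Λ` at `0`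
coincide. -/
lemma rootMultiplicity_one_add_smul (h : IsStableMetzlerSystem Λ k) {Φ : ℝ} (hΦ : Φ ≠ 0) :
    (1 + Φ • Λ).charpoly.rootMultiplicity 1 = k := by
  rw [← h.algebraic_mult, ← Matrix.charpoly_mulVecLin, ← Matrix.charpoly_mulVecLin Λ,
    ← LinearMap.finrank_maxGenEigenspace_eq, ← LinearMap.finrank_maxGenEigenspace_eq]
  have : Module.End.maxGenEigenspace (1 + Φ • Λ).mulVecLin 1 =
      Module.End.maxGenEigenspace Λ.mulVecLin 0 := by
    ext v
    rw [Matrix.mem_maxGenEigenspace_mulVecLin, Matrix.mem_maxGenEigenspace_mulVecLin]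
    refine exists_congr fun m => ?_
    rw [one_smul, add_sub_cancel_left, zero_smul, sub_zero, smul_pow, smul_mulVec,
      smul_eq_zero_iff_right (pow_ne_zero _ hΦ)]
  rw [this]

lemma norm_lt_one_of_mem_spectrum_one_add_smul (h : IsStableMetzlerSystem Λ k) {Φ : ℝ}
    (hΦ : 0 < Φ) (hΦτ : Φ * (destructionMatrix Λ).trace < 1) {z : ℂ}
    (hz : z ∈ spectrum ℂ ((1 + Φ • Λ).map Complex.ofReal)) (hz1 : z ≠ 1) : ‖z‖ < 1 := by
  obtain ⟨v, hv, hzv⟩ := Matrix.exists_eigenvector_of_mem_spectrum hz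
  have hJ : (1 + Φ • Λ).map Complex.ofReal = 1 + (Φ : ℂ) • Λ.map Complex.ofReal := by
    ext i j
    by_cases hij : i = j <;> simp [hij]
  rw [hJ, add_mulVec, one_mulVec, smul_mulVec] at hzv
  have hΦ0 : (Φ : ℂ) ≠ 0 := by exact_mod_cast hΦ.ne'
  have hΛv : Λ.map Complex.ofReal *ᵥ v = ((z - 1) / Φ) • v := by
    rw [div_eq_inv_mul, mul_smul, sub_smul, one_smul, ← hzv, add_sub_cancel_left,
      inv_smul_smul₀ hΦ0]
  have := h.norm_one_add_smul_lt_one hΦ hΦτ (Matrix.mem_spectrum_of_eigenvector hv hΛv)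
    (div_ne_zero (sub_ne_zero.2 hz1) hΦ0)
  rwa [mul_div_cancel₀ _ hΦ0, add_sub_cancel] at this

lemma exists_isLeast (h : IsStableMetzlerSystem Λ k) :
    ∃ M : ℝ, IsLeast {m : ℝ | ∃ z ∈ spectrum ℂ (Λ.map Complex.ofReal), z ≠ 0 ∧
        m = 2 * |z.re| / ‖z‖ ^ 2} M ∧ 1 ≤ M * (destructionMatrix Λ).trace := by
  have hfin : (spectrum ℂ (Λ.map Complex.ofReal) \ {0}).Finite :=
    (Matrix.finite_spectrum _).sdiff
  obtain ⟨w, hw, hw0⟩ := h.exists_mem_spectrum_ne_zero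
  obtain ⟨z, ⟨hz, hz0⟩, hmin⟩ := Set.exists_min_image _ (fun z : ℂ => 2 * |z.re| / ‖z‖ ^ 2) hfin
    ⟨w, hw, hw0⟩
  refine ⟨_, ⟨⟨z, hz, hz0, rfl⟩, ?_⟩, ?_⟩
  · rintro m ⟨u, hu, hu0, rfl⟩
    exact hmin u ⟨hu, hu0⟩
  · have hpos : 0 < ‖z‖ ^ 2 := by
      have : 0 < ‖z‖ := norm_pos_iff.2 hz0
      positivity
    rw [div_mul_eq_mul_div, one_le_div hpos]
    exact h.normSq_le hz

/-! ### GeCo1 as a linear iteration -/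

lemma geco1_eq (h : IsStableMetzlerSystem Λ k) (Δt : ℝ) (y : Fin N → ℝ) :
    geco1 Λ Δt y =
      (1 + (Δt * gecoPhi (Δt * (destructionMatrix Λ).trace)) • Λ) *ᵥ y := by
  have hdiff : productionMatrix Λ - destructionMatrix Λ = Λ := by
    ext i j
    simp only [productionMatrix, destructionMatrix, Matrix.sub_apply, Matrix.map_apply]
    rcases le_total (Λ i j) 0 with h0 | h0
    · rw [max_eq_right h0, max_eq_left (neg_nonneg.2 h0)]; ring
    · rw [max_eq_left h0, max_eq_right (neg_nonpos.2 h0)]; ring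
  have hrel : ∑ i, relativeDestruction Λ y i = (destructionMatrix Λ).trace := by
    refine Finset.sum_congr rfl fun i _ => ?_
    rw [relativeDestruction, Matrix.diag_apply]
    split_ifs with hy
    · rfl
    · rw [Matrix.mulVec, dotProduct, Finset.sum_eq_single i, mul_div_cancel_right₀ _ hy]
      · intro j _ hj
        have : destructionMatrix Λ i j = 0 :=
          max_eq_right (neg_nonpos.2 (h.metzler i j hj.symm))
        rw [this, zero_mul]
      · simp
  rw [geco1, hrel, ← sub_mulVec, hdiff, add_mulVec, one_mulVec, smul_mulVec]

lemma geco1_iterate (h : IsStableMetzlerSystem Λ k) (Δt : ℝ) (m : ℕ) (y : Fin N → ℝ) :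
    (geco1 Λ Δt)^[m] y =
      (1 + (Δt * gecoPhi (Δt * (destructionMatrix Λ).trace)) • Λ) ^ m *ᵥ y := by
  induction m with
  | zero => simp
  | succ m ih => rw [Function.iterate_succ_apply', ih, h.geco1_eq, mulVec_mulVec, pow_succ']

lemma effectiveStep_bounds (h : IsStableMetzlerSystem Λ k) {Δt : ℝ} (hΔt : 0 < Δt) :
    0 < Δt * gecoPhi (Δt * (destructionMatrix Λ).trace) ∧
      Δt * gecoPhi (Δt * (destructionMatrix Λ).trace) * (destructionMatrix Λ).trace < 1 := by
  have hτ := h.trace_pos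
  have hx := mul_pos hΔt hτ
  set x := Δt * (destructionMatrix Λ).trace with hxdef
  have hexp : Real.exp (-x) < 1 := by simpa using hx
  rw [gecoPhi, if_pos hx]
  refine ⟨mul_pos hΔt (div_pos (sub_pos.2 hexp) hx), ?_⟩
  rw [mul_right_comm, ← hxdef, mul_div_cancel₀ _ hx.ne']
  linarith [Real.exp_pos (-x)]

lemma geco1_iterate_sub (h : IsStableMetzlerSystem Λ k) {ystar : Fin N → ℝ}
    (hy : Λ *ᵥ ystar = 0) (Δt : ℝ) (m : ℕ) (y : Fin N → ℝ) :
    (geco1 Λ Δt)^[m] y - ystar =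
      (1 + (Δt * gecoPhi (Δt * (destructionMatrix Λ).trace)) • Λ) ^ m *ᵥ (y - ystar) := by
  have hfix : geco1 Λ Δt ystar = ystar := by
    rw [h.geco1_eq, add_mulVec, smul_mulVec, hy, smul_zero, add_zero, one_mulVec]
  rw [mulVec_sub, ← h.geco1_iterate, ← h.geco1_iterate, Function.iterate_fixed hfix]

lemma isLyapunovStableFixedPoint (h : IsStableMetzlerSystem Λ k) {ystar : Fin N → ℝ}
    (hy : Λ *ᵥ ystar = 0) {Δt : ℝ} (hΔt : 0 < Δt) :
    IsLyapunovStableFixedPoint (geco1 Λ Δt) ystar := by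
  obtain ⟨Q, -, -, hQ⟩ := h.exists_tendsto_pow
  obtain ⟨hΦ, hΦτ⟩ := h.effectiveStep_bounds hΔt
  obtain ⟨C, hC, hbound⟩ := Matrix.exists_norm_pow_mulVec_le_of_tendsto (hQ _ hΦ hΦτ)
  refine ⟨?_, fun ε hε => ⟨ε / C, div_pos hε hC, fun y₀ hy₀ m => ?_⟩⟩
  · have := h.geco1_iterate_sub hy Δt 1 ystar
    rwa [sub_self, mulVec_zero, sub_eq_zero] at this
  · rw [h.geco1_iterate_sub hy]
    refine (hbound m _).trans_lt ?_
    rwa [lt_div_iff₀' hC] at hy₀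

lemma tendsto_geco1_iterate (h : IsStableMetzlerSystem Λ k) {ystar y₀ : Fin N → ℝ}
    (hy : Λ *ᵥ ystar = 0) (hinv : SameLinearInvariants Λ y₀ ystar) {Δt : ℝ} (hΔt : 0 < Δt) :
    Tendsto (fun m : ℕ => (geco1 Λ Δt)^[m] y₀) atTop (𝓝 ystar) := by
  obtain ⟨Q, -, hQΛ, hQ⟩ := h.exists_tendsto_pow
  obtain ⟨hΦ, hΦτ⟩ := h.effectiveStep_bounds hΔt
  have hQy : Q *ᵥ (y₀ - ystar) = 0 := by
    -- Each row of `Q` is a linear invariant because `Q Λ = 0`.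
    ext i
    rw [mulVec_sub, Pi.sub_apply, Pi.zero_apply, sub_eq_zero]
    exact hinv (Q i) (funext fun j => congrFun (congrFun hQΛ i) j)
  have hcont : Continuous fun A : Matrix (Fin N) (Fin N) ℝ => A *ᵥ (y₀ - ystar) :=
    continuous_id.matrix_mulVec continuous_const
  have hlim := (hcont.tendsto Q).comp (hQ _ hΦ hΦτ)
  rw [hQy] at hlim
  have := hlim.add_const ystar
  rw [zero_add] at this
  refine this.congr fun m => ?_
  rw [Function.comp_apply, ← h.geco1_iterate_sub hy, sub_add_cancel]

/-- For `k = 0` the matrix is invertible, so the only invariant is zero and convergence to `0` is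
unconditional. -/
lemma sameLinearInvariants_of_eq_zero (h : IsStableMetzlerSystem Λ 0) (y ystar : Fin N → ℝ) :
    SameLinearInvariants Λ y ystar := by
  intro n hn
  have hdet : Λ.det ≠ 0 := by
    intro h0
    obtain ⟨v, hv, hΛv⟩ := Matrix.exists_mulVec_eq_zero_iff.2 h0
    have hker : LinearMap.ker Λ.mulVecLin = ⊥ := Submodule.finrank_eq_zero.1 h.geometric_mult
    exact hv ((Submodule.eq_bot_iff _).1 hker v (by simpa using hΛv))
  rw [Matrix.eq_zero_of_vecMul_eq_zero hdet hn, zero_dotProduct, zero_dotProduct]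

end IsStableMetzlerSystem

theorem mainTheorem10 {N : ℕ} (Λ : Matrix (Fin N) (Fin N) ℝ) (k : ℕ)
    (hΛ : IsStableMetzlerSystem Λ k) :
    (0 < k → ∀ ystar : Fin N → ℝ, Λ *ᵥ ystar = 0 →
      (∀ Δt : ℝ, 0 < Δt → IsLyapunovStableFixedPoint (geco1 Λ Δt) ystar) ∧
      ∃ δ : ℝ, 0 < δ ∧ ∀ y₀ : Fin N → ℝ, SameLinearInvariants Λ y₀ ystar → ‖y₀ - ystar‖ < δ →
        ∀ Δt : ℝ, 0 < Δt → Tendsto (fun n : ℕ => (geco1 Λ Δt)^[n] y₀) atTop (𝓝 ystar)) ∧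
    (k = 0 → ∀ Δt : ℝ, 0 < Δt →
      IsAsymptoticallyStableFixedPoint (geco1 Λ Δt) (0 : Fin N → ℝ)) ∧
    (∃ M : ℝ,
      IsLeast {m : ℝ | ∃ z ∈ spectrum ℂ (Λ.map Complex.ofReal), z ≠ 0 ∧
        m = 2 * |z.re| / ‖z‖ ^ 2} M ∧
      1 ≤ M * (destructionMatrix Λ).trace) ∧
    (∀ Δt : ℝ, 0 < Δt → ∀ J : Matrix (Fin N) (Fin N) ℝ,
      J = 1 + (Δt * gecoPhi (Δt * (destructionMatrix Λ).trace)) • Λ →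
      J.charpoly.rootMultiplicity 1 = k ∧
      ∀ z ∈ spectrum ℂ (J.map Complex.ofReal), z ≠ 1 → ‖z‖ < 1) := by
  -- The radius `1` is arbitrary: convergence is global for equal invariants.
  refine ⟨fun _ ystar hy => ⟨fun Δt hΔt => hΛ.isLyapunovStableFixedPoint hy hΔt, 1, one_pos,
    fun y₀ hinv _ Δt hΔt => hΛ.tendsto_geco1_iterate hy hinv hΔt⟩, ?_, hΛ.exists_isLeast, ?_⟩
  · rintro rfl Δt hΔt
    refine ⟨hΛ.isLyapunovStableFixedPoint (mulVec_zero _) hΔt, 1, one_pos, fun y₀ _ => ?_⟩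
    exact tendsto_iff_norm_sub_tendsto_zero.1 (hΛ.tendsto_geco1_iterate (mulVec_zero _)
      (hΛ.sameLinearInvariants_of_eq_zero y₀ 0) hΔt)
  · rintro Δt hΔt J rfl
    obtain ⟨hΦ, hΦτ⟩ := hΛ.effectiveStep_bounds hΔt
    exact ⟨hΛ.rootMultiplicity_one_add_smul hΦ.ne', fun z hz hz1 =>
      hΛ.norm_lt_one_of_mem_spectrum_one_add_smul hΦ hΦτ hz hz1⟩
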